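/- For a finite group $G$ let $L(G)$ denote the set of its subgroups, and for $H\in L(G)$ let $$sd(H,G)=\frac{|\{(H_1,G_1)\in L(H)\times L(G)\mid H_1G_1=G_1H_1\}|}{|L(H)|\,|L(G)|}$$ be the relative subgroup commutativity degree of $H$, where $H_1G_1=\{hg\mid h\in H_1,\ g\in G_1\}$. Let $\mathcal C$ be the class of all finite groups $G$ for which the function $L(G)\to[0,1]$, $H\mapsto sd(H,G)$, takes exactly two values. For an integer $n\ge 1$ let $D_{2n}=\langle x,y\mid x^n=y^2=1,\ yxy=x^{-1}\rangle$ be the dihedral group of order $2n$. **Theorem 3.3.** $S_3\cong D_6$ is the unique finite dihedral group contained in $\mathcal C$. That is, $S_3\cong D_6$, and for every integer $n\ge 1$ and every group $G\cong D_{2n}$, one has $G\in\mathcal C$ if and only if $n=3$. -/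

import Mathlib

open scoped Pointwise

/-- The pairs `(H₁, G₁)` with `H₁` a subgroup of `H`, `G₁` a subgroup of `G` and `H₁G₁ = G₁H₁`
as subsets of `G`. The lattice `L(H)` is identified with the set `Set.Iic H` of
subgroups of `G` contained in `H`. -/
def permutingPairs {G : Type*} [Group G] (H : Subgroup G) : Set (Subgroup G × Subgroup G) :=
  {p | p.1 ∈ Set.Iic H ∧ (p.1 : Set G) * (p.2 : Set G) = (p.2 : Set G) * (p.1 : Set G)}

/-- The relative subgroup commutativity degree `sd(H, G)` of a subgroup `H` of `G`
(meaningful for finite `G`). -/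
noncomputable def relSubgroupCommDegree {G : Type*} [Group G] (H : Subgroup G) : ℚ :=
  ((permutingPairs H).ncard : ℚ) / (((Set.Iic H).ncard : ℚ) * (Nat.card (Subgroup G) : ℚ))

/-- `G` is a finite group with exactly two relative subgroup commutativity degrees: the map
`H ↦ sd(H, G)` on the subgroups of `G` takes exactly two values. -/
def HasTwoRelDegrees (G : Type*) [Group G] : Prop :=
  Finite G ∧ (Set.range (relSubgroupCommDegree : Subgroup G → ℚ)).ncard = 2

/-! Counting the pairs that fail to permute gives sd(H, G) = 1 - A(H)/|L(G)|, where A(H)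
(`nonpermutingAverage`) is the mean of `nonpermutingCount` over L(H). So only the number of values
of A matters.

In the dihedral group, rotation subgroups are normal and A vanishes on them. For c ∣ n the count of
⟨r c, sr j⟩ does not depend on j; call it X(c). It is zero if c ∣ 2 and positive if c ≥ 3. If n ≥ 3
and A takes two values, then A is positive on every subgroup containing a reflection, so it equals
X(n)/2 there, its value on ⟨sr j⟩. Hence, whenever md = n, 2 ∑_{b ∣ d} b X(mb) = X(n) ∑_{b ∣ d} (1 +
b).

For n > 3 these linear relations are inconsistent: d = p ≥ 5 prime forces X(m) < 0, d = 3 forces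
X(n/3) = 0, and the remaining n (6, 4 and multiples of 8) are excluded by d = 2, 6, 8. For n = 3 the
only nontrivial relation holds because X(1) = 0; for n ≤ 2 the group is abelian and A is zero. -/

/-- The number of subgroups that do not permute with `K`. -/
noncomputable def nonpermutingCount {G : Type*} [Group G] (K : Subgroup G) : ℕ :=
  {M : Subgroup G | (K : Set G) * (M : Set G) ≠ (M : Set G) * (K : Set G)}.ncard

/-! ### Commutativity degrees as averages of non-permuting counts -/

section General

variable {G G' : Type*} [Group G] [Group G']

theorem nonpermutingCount_eq_zero_of_normal (K : Subgroup G) [K.Normal] :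
    nonpermutingCount K = 0 := by
  have h : {M : Subgroup G | (K : Set G) * (M : Set G) ≠ (M : Set G) * (K : Set G)} = ∅ := by
    ext M
    simp [Subgroup.set_mul_normal_comm (M : Set G) K]
  simp [nonpermutingCount, h]

theorem nonpermutingCount_pos [Finite G] {K M : Subgroup G}
    (h : (K : Set G) * (M : Set G) ≠ (M : Set G) * (K : Set G)) : 0 < nonpermutingCount K :=
  (Set.ncard_pos (Set.toFinite _)).2 ⟨M, h⟩

theorem map_permute_iff (e : G ≃* G') (K M : Subgroup G) :
    ((e.mapSubgroup K : Subgroup G') : Set G') * (e.mapSubgroup M : Subgroup G') =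
        ((e.mapSubgroup M : Subgroup G') : Set G') * (e.mapSubgroup K : Subgroup G') ↔
      (K : Set G) * (M : Set G) = (M : Set G) * (K : Set G) := by
  have h : ∀ A : Subgroup G, ((e.mapSubgroup A : Subgroup G') : Set G') = e '' (A : Set G) :=
    fun A ↦ rfl
  rw [h, h, ← Set.image_mul, ← Set.image_mul]
  exact e.injective.image_injective.eq_iff

theorem nonpermutingCount_mapSubgroup (e : G ≃* G') (K : Subgroup G) :
    nonpermutingCount (e.mapSubgroup K) = nonpermutingCount K := by
  unfold nonpermutingCount
  symm
  refine Set.ncard_congr' (Equiv.subtypeEquiv e.mapSubgroup.toEquiv fun M ↦ ?_)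
  exact (not_congr (map_permute_iff e K M)).symm

theorem relSubgroupCommDegree_mapSubgroup (e : G ≃* G') (H : Subgroup G) :
    relSubgroupCommDegree (e.mapSubgroup H) = relSubgroupCommDegree H := by
  have h1 : (permutingPairs (e.mapSubgroup H)).ncard = (permutingPairs H).ncard := by
    symm
    refine Set.ncard_congr' (Equiv.subtypeEquiv
      (Equiv.prodCongr e.mapSubgroup.toEquiv e.mapSubgroup.toEquiv) fun p ↦ ?_)
    exact and_congr (e.mapSubgroup.le_iff_le).symm (map_permute_iff e p.1 p.2).symm
  have h2 : (Set.Iic (e.mapSubgroup H)).ncard = (Set.Iic H).ncard := by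
    symm
    exact Set.ncard_congr' (Equiv.subtypeEquiv e.mapSubgroup.toEquiv
      fun p ↦ (e.mapSubgroup.le_iff_le).symm)
  unfold relSubgroupCommDegree
  rw [h1, h2, Nat.card_congr e.mapSubgroup.toEquiv]

theorem hasTwoRelDegrees_congr (e : G ≃* G') : HasTwoRelDegrees G ↔ HasTwoRelDegrees G' := by
  have h : Set.range (relSubgroupCommDegree : Subgroup G → ℚ) =
      Set.range (relSubgroupCommDegree : Subgroup G' → ℚ) := by
    rw [← e.mapSubgroup.surjective.range_comp]
    congr 1
    funext H
    exact (relSubgroupCommDegree_mapSubgroup e H).symm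
  unfold HasTwoRelDegrees
  rw [h, e.toEquiv.finite_iff]

open Classical in
/-- The average of `nonpermutingCount` over the subgroups of `H`. -/
noncomputable def nonpermutingAverage [Fintype (Subgroup G)] (H : Subgroup G) : ℚ :=
  ((∑ K with K ≤ H, nonpermutingCount K : ℕ) : ℚ) / ((∑ K with K ≤ H, 1 : ℕ) : ℚ)

open Classical in
theorem ncard_permutingPairs_add [Fintype (Subgroup G)] (H : Subgroup G) :
    (permutingPairs H).ncard + ∑ K with K ≤ H, nonpermutingCount K =
      (∑ K with K ≤ H, 1) * Nat.card (Subgroup G) := by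
  have h1 : (permutingPairs H).ncard = ∑ K with K ≤ H,
      (Finset.univ.filter fun M : Subgroup G ↦
        (K : Set G) * (M : Set G) = (M : Set G) * (K : Set G)).card := by
    rw [← Finset.card_sigma, ← Set.ncard_coe_finset]
    refine Set.ncard_congr' (Equiv.subtypeEquiv (Equiv.sigmaEquivProd _ _).symm fun p ↦ ?_)
    simp [permutingPairs]
  rw [h1, ← Finset.sum_add_distrib, Finset.sum_mul]
  refine Finset.sum_congr rfl fun K _ ↦ ?_
  have h2 : nonpermutingCount K = (Finset.univ.filter fun M : Subgroup G ↦
        ¬ (K : Set G) * (M : Set G) = (M : Set G) * (K : Set G)).card := by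
    rw [← Set.ncard_coe_finset]
    simp [nonpermutingCount]
  rw [h2, Finset.card_filter_add_card_filter_not, one_mul, Nat.card_eq_fintype_card,
    Finset.card_univ]

open Classical in
theorem relSubgroupCommDegree_eq [Fintype (Subgroup G)] (H : Subgroup G) :
    relSubgroupCommDegree H = 1 - nonpermutingAverage H / Nat.card (Subgroup G) := by
  have h1 : (Set.Iic H).ncard = ∑ K with K ≤ H, 1 := by
    rw [← Finset.card_eq_sum_ones, ← Set.ncard_coe_finset]
    congr 1
    ext K
    simp
  have h2 : (∑ K with K ≤ H, 1) ≠ 0 := by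
    rw [← Finset.card_eq_sum_ones, Finset.card_ne_zero]
    exact ⟨H, by simp⟩
  have h3 := ncard_permutingPairs_add H
  have h4 : Nat.card (Subgroup G) ≠ 0 := Nat.card_pos.ne'
  unfold relSubgroupCommDegree nonpermutingAverage
  rw [h1]
  generalize (∑ K with K ≤ H, 1) = L at *
  generalize (∑ K with K ≤ H, nonpermutingCount K) = N at *
  rify at h2 h3 h4
  have h5 : ((permutingPairs H).ncard : ℚ) = L * (Nat.card (Subgroup G) : ℚ) - N := by
    rw [eq_sub_iff_add_eq]
    exact_mod_cast h3
  have h2' : (L : ℚ) ≠ 0 := by exact_mod_cast h2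
  have h4' : (Nat.card (Subgroup G) : ℚ) ≠ 0 := by exact_mod_cast h4
  rw [h5]
  field_simp

theorem hasTwoRelDegrees_iff [Finite G] [Fintype (Subgroup G)] : HasTwoRelDegrees G ↔
    (Set.range (nonpermutingAverage : Subgroup G → ℚ)).ncard = 2 := by
  have h4 : (Nat.card (Subgroup G) : ℚ) ≠ 0 := by exact_mod_cast Nat.card_pos.ne'
  have hinj : Function.Injective fun q : ℚ ↦ 1 - q / (Nat.card (Subgroup G) : ℚ) := by
    intro a b hab
    simp only [sub_right_inj] at hab
    field_simp at hab
    exact hab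
  have h : (relSubgroupCommDegree : Subgroup G → ℚ) =
      (fun q : ℚ ↦ 1 - q / (Nat.card (Subgroup G) : ℚ)) ∘ nonpermutingAverage :=
    funext relSubgroupCommDegree_eq
  rw [HasTwoRelDegrees, h, Set.range_comp, Set.ncard_image_of_injective _ hinj]
  simp_all

theorem not_hasTwoRelDegrees_of_comm [Finite G] (h : ∀ a b : G, a * b = b * a) :
    ¬ HasTwoRelDegrees G := by
  have := Fintype.ofFinite (Subgroup G)
  rw [hasTwoRelDegrees_iff]
  have hz : ∀ K : Subgroup G, nonpermutingCount K = 0 := fun K ↦ by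
    have : K.Normal := ⟨fun a ha g ↦ by rwa [h g a, mul_inv_cancel_right]⟩
    exact nonpermutingCount_eq_zero_of_normal K
  have h0 : (nonpermutingAverage : Subgroup G → ℚ) = fun _ ↦ 0 :=
    funext fun H ↦ by simp [nonpermutingAverage, hz]
  rw [h0, Set.range_const, Set.ncard_singleton]
  norm_num

end General

/-! ### Subgroups of dihedral groups and their non-permuting counts -/

namespace DihedralGroup

variable {n : ℕ}

/-- The subgroup generated by the rotation `r c`. -/
def rotationSubgroup (c : ZMod n) : Subgroup (DihedralGroup n) where
  carrier := {g | ∃ k, g = r k ∧ c ∣ k}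
  one_mem' := ⟨0, rfl, dvd_zero c⟩
  mul_mem' := by
    rintro _ _ ⟨k, rfl, hk⟩ ⟨l, rfl, hl⟩
    exact ⟨k + l, rfl, dvd_add hk hl⟩
  inv_mem' := by
    rintro _ ⟨k, rfl, hk⟩
    exact ⟨-k, rfl, hk.neg_right⟩

/-- The subgroup generated by the rotation `r c` and the reflection `sr j`. -/
def reflectionSubgroup (c j : ZMod n) : Subgroup (DihedralGroup n) where
  carrier := {g | (∃ k, g = r k ∧ c ∣ k) ∨ ∃ k, g = sr k ∧ c ∣ k - j}
  one_mem' := Or.inl ⟨0, rfl, dvd_zero c⟩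
  mul_mem' := by
    rintro _ _ (⟨k, rfl, hk⟩ | ⟨k, rfl, hk⟩) (⟨l, rfl, hl⟩ | ⟨l, rfl, hl⟩)
    · exact Or.inl ⟨k + l, rfl, dvd_add hk hl⟩
    · refine Or.inr ⟨l - k, rfl, ?_⟩
      rw [sub_right_comm]
      exact dvd_sub hl hk
    · refine Or.inr ⟨k + l, rfl, ?_⟩
      rw [add_sub_right_comm]
      exact dvd_add hk hl
    · refine Or.inl ⟨l - k, rfl, ?_⟩
      rw [← sub_sub_sub_cancel_right l k j]
      exact dvd_sub hl hk
  inv_mem' := by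
    rintro _ (⟨k, rfl, hk⟩ | ⟨k, rfl, hk⟩)
    · exact Or.inl ⟨-k, rfl, hk.neg_right⟩
    · exact Or.inr ⟨k, rfl, hk⟩

@[simp]
theorem r_mem_rotationSubgroup {c k : ZMod n} : r k ∈ rotationSubgroup c ↔ c ∣ k :=
  ⟨fun ⟨_, h, hl⟩ ↦ by rw [r.inj h]; exact hl, fun h ↦ ⟨k, rfl, h⟩⟩

@[simp]
theorem sr_mem_rotationSubgroup {c k : ZMod n} : sr k ∈ rotationSubgroup c ↔ False :=
  ⟨fun ⟨_, h, _⟩ ↦ (nomatch h), False.elim⟩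

@[simp]
theorem r_mem_reflectionSubgroup {c j k : ZMod n} : r k ∈ reflectionSubgroup c j ↔ c ∣ k := by
  refine ⟨?_, fun h ↦ Or.inl ⟨k, rfl, h⟩⟩
  rintro (⟨_, h, hl⟩ | ⟨_, h, _⟩)
  · rw [r.inj h]
    exact hl
  · nomatch h

@[simp]
theorem sr_mem_reflectionSubgroup {c j k : ZMod n} :
    sr k ∈ reflectionSubgroup c j ↔ c ∣ k - j := by
  refine ⟨?_, fun h ↦ Or.inr ⟨k, rfl, h⟩⟩
  rintro (⟨_, h, _⟩ | ⟨_, h, hl⟩)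
  · nomatch h
  · rw [sr.inj h]
    exact hl

theorem subgroup_ext {K M : Subgroup (DihedralGroup n)} (hr : ∀ k, r k ∈ K ↔ r k ∈ M)
    (hs : ∀ k, sr k ∈ K ↔ sr k ∈ M) : K = M := by
  ext (k | k)
  exacts [hr k, hs k]

/-- The automorphism fixing the rotations and sending `sr i` to `sr (i + a)`. -/
def shift (a : ZMod n) : DihedralGroup n ≃* DihedralGroup n where
  toFun
    | r i => r i
    | sr i => sr (i + a)
  invFun
    | r i => r i
    | sr i => sr (i - a)
  left_inv := by rintro (i | i) <;> simp
  right_inv := by rintro (i | i) <;> simp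
  map_mul' := by
    rintro (i | i) (j | j) <;> simp <;> ring

theorem mapSubgroup_shift (a c j : ZMod n) :
    (shift a).mapSubgroup (reflectionSubgroup c j) = reflectionSubgroup c (j + a) := by
  have h : ∀ g, g ∈ (shift a).mapSubgroup (reflectionSubgroup c j) ↔
      (shift a).symm g ∈ reflectionSubgroup c j := fun g ↦ Subgroup.mem_map_equiv
  apply subgroup_ext
  · intro k
    rw [h, show (shift a).symm (r k) = r k from rfl]
    simp
  · intro k
    rw [h, show (shift a).symm (sr k) = sr (k - a) from rfl]
    simp only [sr_mem_reflectionSubgroup]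
    rw [sub_sub, add_comm a j]

/-- Conjugation changes `j` only within its class modulo 2, up to sign, so the automorphism `shift`
is used to reach every `j`. -/
theorem nonpermutingCount_reflectionSubgroup (c j : ZMod n) :
    nonpermutingCount (reflectionSubgroup c j) = nonpermutingCount (reflectionSubgroup c 0) := by
  rw [← nonpermutingCount_mapSubgroup (shift j) (reflectionSubgroup c 0), mapSubgroup_shift,
    zero_add]

instance rotationSubgroup_normal (c : ZMod n) : (rotationSubgroup c).Normal where
  conj_mem := by
    rintro (k | k) hk (l | l) <;> simp_all

/-- Conjugation sends `sr k` to `sr (k - 2 * l)` or `sr (2 * l - k)`, and both indices agree with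
`k` modulo `c` when `c ∣ 2`. -/
theorem reflectionSubgroup_normal {c : ZMod n} (hc : c ∣ 2) (j : ZMod n) :
    (reflectionSubgroup c j).Normal where
  conj_mem := by
    rintro (k | k) hk (l | l)
    · simp_all
    · simp_all
    · simp only [sr_mem_reflectionSubgroup, r_mul_sr, inv_r, sr_mul_r] at hk ⊢
      have := dvd_sub hk (hc.mul_right l)
      convert this using 1
      ring
    · simp only [sr_mem_reflectionSubgroup, inv_sr, sr_mul_sr, r_mul_sr] at hk ⊢
      have := dvd_sub (hc.mul_right (l - j)) hk
      convert this using 1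
      ring

/-- Since `c ∣ n`, there is a reduction map from `ZMod n` to `ZMod c`, and it kills every multiple
of `c`. -/
theorem natCast_dvd_natCast_iff {c : ℕ} (hc : c ∣ n) (a : ℕ) :
    (c : ZMod n) ∣ (a : ZMod n) ↔ c ∣ a := by
  refine ⟨?_, fun h ↦ Nat.cast_dvd_cast h⟩
  rintro ⟨t, ht⟩
  have h := congrArg (ZMod.castHom hc (ZMod c)) ht
  rw [map_mul, map_natCast, map_natCast, ZMod.natCast_self, zero_mul] at h
  exact (ZMod.natCast_eq_zero_iff a c).1 h

theorem natCast_dvd_intCast_iff {c : ℕ} (hc : c ∣ n) (a : ℤ) :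
    (c : ZMod n) ∣ (a : ZMod n) ↔ (c : ℤ) ∣ a := by
  constructor
  · rintro ⟨t, ht⟩
    have h := congrArg (ZMod.castHom hc (ZMod c)) ht
    rw [map_mul, map_natCast, map_intCast, ZMod.natCast_self, zero_mul] at h
    exact (ZMod.intCast_zmod_eq_zero_iff_dvd a c).1 h
  · rintro ⟨t, rfl⟩
    exact ⟨(t : ZMod n), by push_cast; ring⟩

theorem nonpermutingCount_reflectionSubgroup_eq_zero {c : ℕ} (hc : c ∣ 2) (j : ZMod n) :
    nonpermutingCount (reflectionSubgroup (c : ZMod n) j) = 0 := by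
  have hc' : (c : ZMod n) ∣ 2 := by
    simpa using (Nat.cast_dvd_cast hc : ((c : ℕ) : ZMod n) ∣ ((2 : ℕ) : ZMod n))
  have := reflectionSubgroup_normal hc' j
  exact nonpermutingCount_eq_zero_of_normal _

theorem nonpermutingCount_reflectionSubgroup_pos [NeZero n] {c : ℕ} (hc : c ∣ n) (h3 : 3 ≤ c) :
    0 < nonpermutingCount (reflectionSubgroup (c : ZMod n) 0) := by
  apply nonpermutingCount_pos (M := reflectionSubgroup (0 : ZMod n) 1)
  intro h
  have h1 : ¬ (c : ZMod n) ∣ 1 := by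
    have := natCast_dvd_natCast_iff hc 1
    rw [Nat.cast_one] at this
    rw [this]
    exact fun h ↦ by have := Nat.le_of_dvd one_pos h; omega
  have h2 : ¬ (c : ZMod n) ∣ 2 := by
    have := natCast_dvd_natCast_iff hc 2
    rw [Nat.cast_two] at this
    rw [this]
    exact fun h ↦ by have := Nat.le_of_dvd two_pos h; omega
  -- The witness is ⟨sr 1⟩, of order two: `sr 1 * sr 0 = r (-1)`. Factoring `r (-1)` in the other
  -- order would put `r (-1)` or `sr 2` in ⟨r c, sr 0⟩, that is, `c ∣ 1` or `c ∣ 2`.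
  have hm : (r (-1) : DihedralGroup n) ∈ ((reflectionSubgroup (0 : ZMod n) 1 : Subgroup _) :
      Set (DihedralGroup n)) * (reflectionSubgroup (c : ZMod n) 0 : Subgroup _) :=
    Set.mem_mul.2 ⟨sr 1, by simp, sr 0, by simp, by simp⟩
  rw [← h] at hm
  obtain ⟨a, ha, b, hb, hab⟩ := Set.mem_mul.1 hm
  rw [SetLike.mem_coe] at ha hb
  rcases b with k | k
  · simp only [r_mem_reflectionSubgroup, zero_dvd_iff] at hb
    subst hb
    rw [← one_def, mul_one] at hab
    subst hab
    rw [r_mem_reflectionSubgroup, dvd_neg] at ha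
    exact h1 ha
  · simp only [sr_mem_reflectionSubgroup, zero_dvd_iff, sub_eq_zero] at hb
    subst hb
    obtain rfl : a = sr 2 := by
      rw [eq_mul_inv_of_mul_eq hab, inv_sr, r_mul_sr]
      congr 1
      ring
    rw [sr_mem_reflectionSubgroup, sub_zero] at ha
    exact h2 ha

/-! ### Classification of subgroups and sums over them -/

theorem exists_eq_rotationSubgroup_or_reflectionSubgroup [NeZero n]
    (K : Subgroup (DihedralGroup n)) :
    ∃ c : ℕ, c ∣ n ∧ (K = rotationSubgroup (c : ZMod n) ∨
      ∃ j : ZMod n, K = reflectionSubgroup (c : ZMod n) j) := by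
  -- The rotation part is pulled back to ℤ, where subgroups are cyclic; the pullback contains `n`,
  -- so its generator divides `n`.
  let A : AddSubgroup ℤ :=
    { carrier := {k | (r (k : ZMod n)) ∈ K}
      zero_mem' := by
        rw [Set.mem_ofPred_eq, Int.cast_zero]
        exact K.one_mem
      add_mem' := by
        intro a b ha hb
        rw [Set.mem_ofPred_eq, Int.cast_add]
        exact K.mul_mem ha hb
      neg_mem' := by
        intro a ha
        rw [Set.mem_ofPred_eq, Int.cast_neg]
        exact K.inv_mem ha }
  have hA : ∀ k : ℤ, k ∈ A ↔ r (k : ZMod n) ∈ K := fun k ↦ Iff.rfl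
  obtain ⟨g, hg⟩ := Int.subgroup_cyclic A
  have hA' : ∀ k : ℤ, r (k : ZMod n) ∈ K ↔ (g.natAbs : ℤ) ∣ k := fun k ↦ by
    rw [← hA, hg, AddSubgroup.mem_closure_singleton, Int.natAbs_dvd]
    simp only [smul_eq_mul, dvd_def, mul_comm g, eq_comm]
  have hgn : g.natAbs ∣ n := by
    rw [← Int.natCast_dvd_natCast, ← hA', Int.cast_natCast, ZMod.natCast_self]
    exact K.one_mem
  have hr : ∀ k : ZMod n, r k ∈ K ↔ (g.natAbs : ZMod n) ∣ k := fun k ↦ by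
    obtain ⟨k, rfl⟩ := ZMod.intCast_surjective k
    rw [hA', natCast_dvd_intCast_iff hgn]
  refine ⟨g.natAbs, hgn, ?_⟩
  by_cases h : ∃ j, sr j ∈ K
  · obtain ⟨j, hj⟩ := h
    refine Or.inr ⟨j, subgroup_ext (fun k ↦ by rw [hr, r_mem_reflectionSubgroup]) fun k ↦ ?_⟩
    rw [sr_mem_reflectionSubgroup, ← hr, ← sr_mul_sr, K.mul_mem_cancel_left hj]
  · refine Or.inl (subgroup_ext (fun k ↦ by rw [hr, r_mem_rotationSubgroup]) fun k ↦ ?_)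
    simp only [sr_mem_rotationSubgroup, iff_false]
    exact fun hk ↦ h ⟨k, hk⟩

theorem rotationSubgroup_le_iff {c m i : ZMod n} :
    rotationSubgroup c ≤ reflectionSubgroup m i ↔ m ∣ c := by
  refine ⟨fun h ↦ ?_, ?_⟩
  · simpa using h (r_mem_rotationSubgroup.2 (dvd_refl c))
  · rintro h (k | k) hk
    · rw [r_mem_rotationSubgroup] at hk
      exact r_mem_reflectionSubgroup.2 (h.trans hk)
    · simp at hk

theorem reflectionSubgroup_le_iff {c j m i : ZMod n} :
    reflectionSubgroup c j ≤ reflectionSubgroup m i ↔ m ∣ c ∧ m ∣ j - i := by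
  refine ⟨fun h ↦ ⟨?_, ?_⟩, ?_⟩
  · simpa using h (r_mem_reflectionSubgroup.2 (dvd_refl c))
  · exact sr_mem_reflectionSubgroup.1 (h (sr_mem_reflectionSubgroup.2 (by simp)))
  · rintro ⟨h, h'⟩ (k | k) hk
    · rw [r_mem_reflectionSubgroup] at hk
      exact r_mem_reflectionSubgroup.2 (h.trans hk)
    · rw [sr_mem_reflectionSubgroup] at hk ⊢
      rw [← sub_add_sub_cancel k j i]
      exact dvd_add (h.trans hk) h'

theorem reflectionSubgroup_congr {c j j' : ZMod n} (h : c ∣ j - j') :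
    reflectionSubgroup c j = reflectionSubgroup c j' :=
  le_antisymm (reflectionSubgroup_le_iff.2 ⟨dvd_rfl, h⟩)
    (reflectionSubgroup_le_iff.2 ⟨dvd_rfl, by rwa [dvd_sub_comm]⟩)

/-- The subgroups of `reflectionSubgroup m i`, parametrized by a divisor `b` of `n / m` and the
class modulo `b` of a reflection, if there is one. -/
def subgroupOfPair (m : ℕ) (i : ZMod n) : (Σ b : ℕ, Option (Fin b)) → Subgroup (DihedralGroup n)
  | ⟨b, none⟩ => rotationSubgroup ((m * b : ℕ) : ZMod n)
  | ⟨b, some t⟩ => reflectionSubgroup ((m * b : ℕ) : ZMod n) (i + ((m * t : ℕ) : ZMod n))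

-- Each b ∣ d gives one rotation subgroup and b reflection subgroups, because a class modulo m
-- splits into b classes modulo mb. By `hg` these b subgroups contribute equally.
open Classical in
theorem sum_le_reflectionSubgroup [NeZero n] [Fintype (Subgroup (DihedralGroup n))] {m d : ℕ}
    (hmd : m * d = n) (i : ZMod n) (g : Subgroup (DihedralGroup n) → ℕ)
    (hg : ∀ c j, g (reflectionSubgroup c j) = g (reflectionSubgroup c 0)) :
    ∑ K with K ≤ reflectionSubgroup (m : ZMod n) i, g K = ∑ b ∈ d.divisors,
      (g (rotationSubgroup ((m * b : ℕ) : ZMod n)) +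
        b * g (reflectionSubgroup ((m * b : ℕ) : ZMod n) 0)) := by
  have hn : n ≠ 0 := NeZero.ne n
  have hm : m ≠ 0 := by rintro rfl; simp at hmd; exact hn hmd.symm
  have hd : d ≠ 0 := by rintro rfl; simp at hmd; exact hn hmd.symm
  have hmn : m ∣ n := ⟨d, hmd.symm⟩
  have hbn : ∀ {b}, b ∣ d → m * b ∣ n := fun h ↦ hmd ▸ mul_dvd_mul_left m h
  have key : ∑ p ∈ d.divisors.sigma fun b ↦ (Finset.univ : Finset (Option (Fin b))),
      g (subgroupOfPair m i p) = ∑ K with K ≤ reflectionSubgroup (m : ZMod n) i, g K := by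
    refine Finset.sum_nbij (subgroupOfPair m i) ?_ ?_ ?_ fun _ _ ↦ rfl
    · rintro ⟨b, _ | t⟩ -
      · simp only [Finset.mem_filter, Finset.mem_univ, true_and, subgroupOfPair]
        exact rotationSubgroup_le_iff.2 (Nat.cast_dvd_cast (dvd_mul_right m b))
      · simp only [Finset.mem_filter, Finset.mem_univ, true_and, subgroupOfPair]
        refine reflectionSubgroup_le_iff.2 ⟨Nat.cast_dvd_cast (dvd_mul_right m b), ?_⟩
        rw [add_sub_cancel_left]
        exact Nat.cast_dvd_cast (dvd_mul_right m t)
    · rintro ⟨b, o⟩ hb ⟨b', o'⟩ hb' h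
      simp only [Finset.coe_sigma, Set.mem_sigma_iff, Finset.mem_coe, Nat.mem_divisors] at hb hb'
      have hr : ∀ (b : ℕ) (o : Option (Fin b)) k, r k ∈ subgroupOfPair m i ⟨b, o⟩ ↔
          ((m * b : ℕ) : ZMod n) ∣ k := by
        rintro b (_ | t) k <;> simp [subgroupOfPair]
      have hbb : b = b' := by
        apply Nat.eq_of_mul_eq_mul_left (Nat.pos_of_ne_zero hm)
        apply Nat.dvd_antisymm
        · rw [← natCast_dvd_natCast_iff (hbn hb.1.1), ← hr b o, h, hr]
        · rw [← natCast_dvd_natCast_iff (hbn hb'.1.1), ← hr b' o', ← h, hr]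
      subst hbb
      rcases o with _ | t <;> rcases o' with _ | t'
      · rfl
      · have := (SetLike.ext_iff.1 h (sr (i + ((m * t' : ℕ) : ZMod n))))
        simp [subgroupOfPair] at this
      · have := (SetLike.ext_iff.1 h (sr (i + ((m * t : ℕ) : ZMod n))))
        simp [subgroupOfPair] at this
      · have h1 := (reflectionSubgroup_le_iff.1 (le_of_eq h)).2
        have h2 : (i + ((m * t : ℕ) : ZMod n)) - (i + ((m * t' : ℕ) : ZMod n)) =
            ((m * ((t : ℕ) - (t' : ℕ) : ℤ) : ℤ) : ZMod n) := by
          push_cast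
          ring
        rw [h2, natCast_dvd_intCast_iff (hbn hb.1.1), Nat.cast_mul,
          mul_dvd_mul_iff_left (by exact_mod_cast hm)] at h1
        have h3 : ((t : ℕ) - (t' : ℕ) : ℤ) = 0 := by
          apply Int.eq_zero_of_abs_lt_dvd h1
          rw [abs_lt]
          omega
        have h4 : t = t' := Fin.ext (by omega)
        rw [h4]
    · intro K hK
      simp only [Finset.coe_filter, Finset.mem_univ, true_and, Set.mem_ofPred_eq] at hK
      obtain ⟨c, hcn, rfl | ⟨j, rfl⟩⟩ := exists_eq_rotationSubgroup_or_reflectionSubgroup K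
      · rw [rotationSubgroup_le_iff, natCast_dvd_natCast_iff hmn] at hK
        obtain ⟨b, rfl⟩ := hK
        rw [← hmd, Nat.mul_dvd_mul_iff_left (Nat.pos_of_ne_zero hm)] at hcn
        exact ⟨⟨b, none⟩, by simp [hcn, hd], rfl⟩
      · obtain ⟨hK, t, ht⟩ := reflectionSubgroup_le_iff.1 hK
        rw [natCast_dvd_natCast_iff hmn] at hK
        obtain ⟨b, rfl⟩ := hK
        rw [← hmd, Nat.mul_dvd_mul_iff_left (Nat.pos_of_ne_zero hm)] at hcn
        have hb : 0 < b := Nat.pos_of_dvd_of_pos hcn (Nat.pos_of_ne_zero hd)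
        -- Here `j - i = m * t`, and modulo `m * b` only the residue of `t` modulo `b` matters.
        refine ⟨⟨b, some ⟨t.val % b, Nat.mod_lt _ hb⟩⟩, by simp [hcn, hd], ?_⟩
        refine (reflectionSubgroup_congr ?_).symm
        have h1 : ((t.val : ℕ) : ZMod n) = t := ZMod.natCast_zmod_val t
        refine ⟨((t.val / b : ℕ) : ZMod n), ?_⟩
        have h2 : t = ((b * (t.val / b) + t.val % b : ℕ) : ZMod n) := by
          rw [Nat.div_add_mod, h1]
        push_cast at h2 ⊢
        linear_combination ht + (m : ZMod n) * h2
  rw [← key, Finset.sum_sigma]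
  refine Finset.sum_congr rfl fun b _ ↦ ?_
  rw [Fintype.sum_option]
  congr 1
  simp only [subgroupOfPair]
  rw [Finset.sum_congr rfl fun t _ ↦ hg _ _]
  simp

/-! ### Averages over dihedral subgroups and the resulting linear relations -/

section Average

variable [NeZero n] [Fintype (Subgroup (DihedralGroup n))]

theorem nonpermutingAverage_reflectionSubgroup {m d : ℕ} (hmd : m * d = n) (i : ZMod n) :
    nonpermutingAverage (reflectionSubgroup (m : ZMod n) i) =
      ((∑ b ∈ d.divisors,
        b * nonpermutingCount (reflectionSubgroup ((m * b : ℕ) : ZMod n) 0) : ℕ) : ℚ) /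
      ((∑ b ∈ d.divisors, (1 + b) : ℕ) : ℚ) := by
  unfold nonpermutingAverage
  rw [sum_le_reflectionSubgroup hmd i _ nonpermutingCount_reflectionSubgroup,
    sum_le_reflectionSubgroup hmd i (fun _ ↦ 1) fun _ _ ↦ rfl]
  simp [nonpermutingCount_eq_zero_of_normal]

open Classical in
theorem nonpermutingAverage_rotationSubgroup (c : ZMod n) :
    nonpermutingAverage (rotationSubgroup c) = 0 := by
  unfold nonpermutingAverage
  rw [Finset.sum_eq_zero, Nat.cast_zero, zero_div]
  intro K hK
  rw [Finset.mem_filter] at hK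
  obtain ⟨a, -, rfl | ⟨j, rfl⟩⟩ := exists_eq_rotationSubgroup_or_reflectionSubgroup K
  · exact nonpermutingCount_eq_zero_of_normal _
  · exact absurd (hK.2 (sr_mem_reflectionSubgroup.2 (by simp : _ ∣ j - j))) (by simp)

theorem nonpermutingAverage_order_two (i : ZMod n) :
    nonpermutingAverage (reflectionSubgroup (n : ZMod n) i) =
      (nonpermutingCount (reflectionSubgroup (n : ZMod n) 0) : ℚ) / 2 := by
  rw [nonpermutingAverage_reflectionSubgroup (mul_one n)]
  simp [one_add_one_eq_two]

theorem two_mul_sum_of_hasTwoRelDegrees (h3 : 3 ≤ n) (h : HasTwoRelDegrees (DihedralGroup n))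
    {m d : ℕ} (hmd : m * d = n) :
    2 * ∑ b ∈ d.divisors, b * nonpermutingCount (reflectionSubgroup ((m * b : ℕ) : ZMod n) 0) =
      nonpermutingCount (reflectionSubgroup (n : ZMod n) 0) * ∑ b ∈ d.divisors, (1 + b) := by
  have hd : d ∈ d.divisors :=
    Nat.mem_divisors_self d (by rintro rfl; simp at hmd; exact NeZero.ne n hmd.symm)
  have hx := nonpermutingCount_reflectionSubgroup_pos (dvd_refl n) h3
  have hN : 0 < ∑ b ∈ d.divisors,
      b * nonpermutingCount (reflectionSubgroup ((m * b : ℕ) : ZMod n) 0) :=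
    Finset.sum_pos' (fun _ _ ↦ Nat.zero_le _)
      ⟨d, hd, by rw [hmd]; exact Nat.mul_pos (Nat.pos_of_mem_divisors hd) hx⟩
  have hL : 0 < ∑ b ∈ d.divisors, (1 + b) :=
    Finset.sum_pos' (fun _ _ ↦ Nat.zero_le _) ⟨d, hd, by omega⟩
  rw [hasTwoRelDegrees_iff, Set.ncard_eq_two] at h
  obtain ⟨u, v, -, huv⟩ := h
  have hmem : ∀ H : Subgroup (DihedralGroup n),
      nonpermutingAverage H = u ∨ nonpermutingAverage H = v := fun H ↦ by
    simpa [huv] using Set.mem_range_self (f := nonpermutingAverage) H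
  have h0 := hmem (rotationSubgroup 0)
  have h1 := hmem (reflectionSubgroup (n : ZMod n) 0)
  have h2 := hmem (reflectionSubgroup (m : ZMod n) 0)
  rw [nonpermutingAverage_rotationSubgroup] at h0
  rw [nonpermutingAverage_order_two] at h1
  rw [nonpermutingAverage_reflectionSubgroup hmd] at h2
  generalize (∑ b ∈ d.divisors,
    b * nonpermutingCount (reflectionSubgroup ((m * b : ℕ) : ZMod n) 0)) = N at *
  generalize (∑ b ∈ d.divisors, (1 + b)) = L at *
  generalize nonpermutingCount (reflectionSubgroup (n : ZMod n) 0) = x at *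
  have hx' : (0 : ℚ) < x := by exact_mod_cast hx
  have hN' : (0 : ℚ) < N := by exact_mod_cast hN
  have hL' : (0 : ℚ) < L := by exact_mod_cast hL
  have e1 : (0 : ℚ) < x / 2 := by positivity
  have e2 : (0 : ℚ) < N / L := by positivity
  -- The value 0 is already taken by the trivial subgroup, so two positive values must coincide.
  have e : (N : ℚ) / L = x / 2 := by
    rcases h0 with h0 | h0 <;> rcases h1 with h1 | h1 <;> rcases h2 with h2 | h2 <;> linarith
  rw [div_eq_div_iff hL'.ne' two_ne_zero] at e
  have e' : N * 2 = x * L := by exact_mod_cast e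
  omega

end Average

/-! ### Inconsistency of the relations for n > 3, and the case n = 3 -/

theorem not_hasTwoRelDegrees [NeZero n] (h1 : n ≠ 1) (h2 : n ≠ 2) (h3 : n ≠ 3) :
    ¬ HasTwoRelDegrees (DihedralGroup n) := by
  intro h
  have := Fintype.ofFinite (Subgroup (DihedralGroup n))
  have hn : n ≠ 0 := NeZero.ne n
  have key := fun {m d : ℕ} ↦ two_mul_sum_of_hasTwoRelDegrees (n := n) (m := m) (d := d)
    (by omega) h
  have hpos := fun {c : ℕ} ↦ nonpermutingCount_reflectionSubgroup_pos (n := n) (c := c)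
  have hzero := fun {c : ℕ} (hc : c ∣ 2) ↦ nonpermutingCount_reflectionSubgroup_eq_zero
    (n := n) hc 0
  have hx := hpos (dvd_refl n) (by omega)
  have D2 : Nat.divisors 2 = {1, 2} := by decide
  have D3 : Nat.divisors 3 = {1, 3} := by decide
  have D6 : Nat.divisors 6 = {1, 2, 3, 6} := by decide
  have D8 : Nat.divisors 8 = {1, 2, 4, 8} := by decide
  generalize hX : (fun c : ℕ ↦ nonpermutingCount (reflectionSubgroup (c : ZMod n) 0)) = X at *
  have hX' : ∀ c : ℕ, nonpermutingCount (reflectionSubgroup (c : ZMod n) 0) = X c :=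
    fun c ↦ congrFun hX c
  simp only [hX'] at key hpos hzero hx
  by_cases h3n : 3 ∣ n
  · obtain ⟨m, hm⟩ := h3n
    by_cases h6 : n = 6
    · subst h6
      have k2 := key (m := 3) (d := 2) rfl
      have k6 := key (m := 1) (d := 6) rfl
      have z1 := hzero (c := 1) (by decide)
      have z2 := hzero (c := 2) (by decide)
      simp [D2] at k2
      simp [D6] at k6
      -- `k2` says 2X(3) = X(6) and `k6` says 6X(3) = 4X(6), so X(6) = 0.
      omega
    · have k := key (m := m) (d := 3) (by omega)
      simp only [D3] at k
      rw [Finset.sum_pair (by decide), Finset.sum_pair (by decide), mul_one, mul_comm m 3,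
        ← hm] at k
      -- `k` reduces to X(m) = 0, while n ≥ 9 gives m ≥ 3.
      have := hpos (c := m) ⟨3, by omega⟩ (by omega)
      omega
  · by_cases h8 : 8 ∣ n
    · obtain ⟨m, hm⟩ := h8
      have k2 := key (m := m * 4) (d := 2) (by omega)
      have k8 := key (m := m) (d := 8) (by omega)
      have e1 : m * 4 * 2 = n := by omega
      have e2 : m * 8 = n := by omega
      simp [D2, e1] at k2
      simp [D8, e2] at k8
      -- `k2` gives 2X(4m) = X(n); then the left side of `k8` is at least (4 + 16)X(n), exceeding
      -- its right side 19X(n).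
      omega
    · by_cases h4 : n = 4
      · subst h4
        have k2 := key (m := 2) (d := 2) rfl
        have z2 := hzero (c := 2) (by decide)
        simp [D2] at k2
        omega
      · obtain ⟨p, hp, hpn, hp5⟩ : ∃ p, p.Prime ∧ p ∣ n ∧ 5 ≤ p := by
          by_contra! hcon
          have h2p : ∀ {q : ℕ}, q.Prime → q ∣ n → q = 2 := fun {q} hq hqn ↦ by
            have h5 := hcon q hq hqn
            have := hq.two_le
            interval_cases q
            · rfl
            · exact absurd hqn h3n
            · exact absurd hq (by decide)
          have hpow := Nat.eq_prime_pow_of_unique_prime_dvd hn h2p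
          generalize n.primeFactorsList.length = k at hpow
          rcases Nat.lt_or_ge k 3 with hk | hk
          · interval_cases k <;> omega
          · exact h8 (hpow ▸ pow_dvd_pow 2 hk)
        obtain ⟨m, hm⟩ := hpn
        have k := key (m := m) (d := p) (by rw [hm, mul_comm])
        rw [hp.divisors, Finset.sum_pair hp.one_lt.ne, Finset.sum_pair hp.one_lt.ne,
          mul_comm m p, ← hm] at k
        -- `k` reads 2X(m) + 2pX(n) = (p + 3)X(n), impossible for p ≥ 5 and X(n) > 0.
        nlinarith

theorem hasTwoRelDegrees_three : HasTwoRelDegrees (DihedralGroup 3) := by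
  have := Fintype.ofFinite (Subgroup (DihedralGroup 3))
  have hx := nonpermutingCount_reflectionSubgroup_pos (dvd_refl 3) le_rfl
  have hx1 := nonpermutingCount_reflectionSubgroup_eq_zero (n := 3) (one_dvd 2) 0
  have h : Set.range (nonpermutingAverage : Subgroup (DihedralGroup 3) → ℚ) =
      {0, (nonpermutingCount (reflectionSubgroup ((3 : ℕ) : ZMod 3) 0) : ℚ) / 2} := by
    apply Set.Subset.antisymm
    · rintro _ ⟨K, rfl⟩
      obtain ⟨c, hc, rfl | ⟨j, rfl⟩⟩ := exists_eq_rotationSubgroup_or_reflectionSubgroup K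
      · exact Or.inl (nonpermutingAverage_rotationSubgroup _)
      · right
        rcases (Nat.dvd_prime Nat.prime_three).1 hc with rfl | rfl
        -- For the whole group X(1) = 0, so the average is 3X(3)/6, the same as for order two.
        · rw [nonpermutingAverage_reflectionSubgroup (one_mul 3),
            show Nat.divisors 3 = {1, 3} by decide, Finset.sum_pair (by decide),
            Finset.sum_pair (by decide), one_mul, one_mul, one_mul, hx1, Set.mem_singleton_iff]
          push_cast
          ring
        · exact nonpermutingAverage_order_two j
    · rintro _ (rfl | rfl)
      · exact ⟨_, nonpermutingAverage_rotationSubgroup 0⟩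
      · exact ⟨_, nonpermutingAverage_order_two 0⟩
  rw [hasTwoRelDegrees_iff, h, Set.ncard_pair]
  have : (0 : ℚ) < nonpermutingCount (reflectionSubgroup ((3 : ℕ) : ZMod 3) 0) := by
    exact_mod_cast hx
  exact (by positivity : (0 : ℚ) < _).ne

theorem hasTwoRelDegrees_iff_eq_three [NeZero n] :
    HasTwoRelDegrees (DihedralGroup n) ↔ n = 3 := by
  refine ⟨fun h ↦ ?_, ?_⟩
  · by_contra h3
    by_cases h1 : n = 1
    · subst h1
      exact not_hasTwoRelDegrees_of_comm (by decide) h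
    by_cases h2 : n = 2
    · subst h2
      exact not_hasTwoRelDegrees_of_comm (by decide) h
    exact not_hasTwoRelDegrees h1 h2 h3 h
  · rintro rfl
    exact hasTwoRelDegrees_three

/-- The action of `DihedralGroup 3` on the vertices of a triangle. -/
def permOfThree : DihedralGroup 3 →* Equiv.Perm (Fin 3) where
  toFun
    -- The sign matches the convention `r i * sr j = sr (j - i)`.
    | r i => (Equiv.addRight (-i) : Equiv.Perm (ZMod 3))
    | sr i => (Equiv.subLeft i : Equiv.Perm (ZMod 3))
  map_one' := by decide
  map_mul' := by decide

theorem permOfThree_bijective : Function.Bijective permOfThree := by decide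

end DihedralGroup

theorem theorem3p3 :
    Nonempty (Equiv.Perm (Fin 3) ≃* DihedralGroup 3) ∧
      ∀ (G : Type*) [Group G] (n : ℕ), 1 ≤ n → Nonempty (G ≃* DihedralGroup n) →
        (HasTwoRelDegrees G ↔ n = 3) := by
  refine ⟨⟨(MulEquiv.ofBijective _ DihedralGroup.permOfThree_bijective).symm⟩, ?_⟩
  rintro G _ n hn ⟨e⟩
  have : NeZero n := ⟨by omega⟩
  rw [hasTwoRelDegrees_congr e, DihedralGroup.hasTwoRelDegrees_iff_eq_three]
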